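/- **Setting.** All complexes are finite abstract simplicial complexes; $V(K)$ is the vertex set of $K$ and $S_i(K)$ is the set of its $i$-faces (faces with $i+1$ vertices). Every face $F$ carries an arbitrarily chosen orientation $[F]$, and for an $i$-face $F$ and an $(i+1)$-face $\bar F$ let $\operatorname{sgn}([F],\partial[\bar F])\in\{0,1,-1\}$ be the coefficient of $[F]$ in the boundary of $[\bar F]$. Faces have positive real weights $w_K$, $W_i(K)$ is the diagonal matrix of the weights of the $i$-faces, $D_i(K)=\big(\operatorname{sgn}([F],\partial[\bar F])\big)_{\bar F\in S_{i+1}(K),\,F\in S_i(K)}$ is the matrix of the coboundary map, and $\mathcal L_i^{up}(K)=W_i(K)^{-1}D_i(K)^\top W_{i+1}(K)D_i(K)$ is the matrix of the $i$-up Laplace operator. A vertex map $\phi:V(K)\to V(M)$ is a *$k$-fold (strong) covering* $K\to M$ if $K$ is connected; $\phi$ is simplicial; for every face $G$ of $M$ the faces $F$ of $K$ with $\phi(F)=G$ are mapped bijectively onto $G$, are pairwise disjoint, and have union $\{v : \phi(v)\in G\}$; whenever $G\in S_i(M)$ is contained in $\bar G\in S_{i+1}(M)$, every $F\in S_i(K)$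 with $\phi(F)=G$ is contained in some $\bar F\in S_{i+1}(K)$ with $\phi(\bar F)=\bar G$; and for all $i\ge 0$ there are exactly $k$ faces $F \in S_i(K)$ over every $G\in S_i(M)$. The incidence graph $B_i(M)$ has vertex set $S_i(M)\sqcup S_{i+1}(M)$, with $G\in S_i(M)$ and $\bar G\in S_{i+1}(M)$ adjacent iff $G\subset\bar G$. A permutation voltage assignment $\psi$ assigns to each arc $(u,v)$ of $B_i(M)$ a permutation $\psi(u,v)$ of $[k]=\{1,\dots,k\}$ with $\psi(v,u)=\psi(u,v)^{-1}$. The derived graph $B_i(M)^\psi$ has the vertices of $B_i(M)$ times $[k]$ as its vertex set, with $(u,a)$ adjacent to $(v,b)$ iff $u$ is adjacent to $v$ and $a=\psi(u,v)(b)$. **Theorem.** Let $\phi:K\to M$ be a $k$-fold covering with $w_K(F)=w_M(\phi(F))$ for all faces $F$ of $K$, and let $i\ge 0$. Let $\psi$ be a permutation voltage assignment on $B_i(M)$, and let $\eta:B_i(M)^\psi\to B_i(K)$ be a graph isomorphism which maps $S_i(M)\times[k]$ to $S_i(K)$ and $S_{i+1}(M)\times[k]$ to $S_{i+1}(K)$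 and satisfies $\phi(\eta(u,a))=u$ for all $u$ and $a$. Let $\Psi_i\le\mathbb S_k$ be the group generated by the permutations assigned by $\psi$, and for $g\in\Psi_i$ let $P^g$ be the permutation matrix with $P^g_{ab}=1$ iff $a=g(b)$. Let $\varrho_2,\dots,\varrho_t$ be irreducible complex matrix representations of $\Psi_i$ (trivial ones are allowed), and let $T$ be an invertible complex matrix such that, for all $g\in\Psi_i$, $$T^{-1}P^gT=I_1\oplus\varrho_2(g)\oplus\cdots\oplus\varrho_t(g).$$ Let $\Lambda_i(M)^\eta$ be the diagonal matrix on $S_i(M)\times[k]$ whose entry at $(G,a)$ is the sign ($\pm1$) of the $\phi$-image of the oriented face $[\eta(G,a)]$ relative to $[G]$. For $g\in\Psi_i$ let $D_i^g(M)$ be the matrix which agrees with $D_i(M)$ at the entries $(\bar G,G)$ with $G\subset\bar G$ and $\psi(\bar G,G)=g$, and is $0$ elsewhere. Index the rows and columns of $\mathcal L_i^{up}(K)$ by $S_i(M)\times[k]$ by means of $\eta$. Then $$(I\otimes T)^{-1}\,\Lambda_i(M)^\eta\,\mathcal L_i^{up}(K)\,(\Lambda_i(M)^\eta)^{-1}\,(I\otimes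 T)$$ $$=\mathcal L_i^{up}(M)\oplus\bigoplus_{j=2}^t\Big(\sum_{g\in\Psi_i}\big(W_i(M)^{-1}D_i^g(M)^\top\big)\otimes\varrho_j(g^{-1})\Big)\Big(\sum_{g\in\Psi_i}\big(W_{i+1}(M)D_i^g(M)\big)\otimes\varrho_j(g)\Big),$$ where on the right-hand side the index set is identified with that of the left-hand side by the canonical relabelling $A\otimes(B\oplus C)\cong(A\otimes B)\oplus(A\otimes C)$. -/

import Mathlib

open scoped Kronecker Matrix

noncomputable section

namespace CoveringComplex

open Matrix

/-! ### Simplicial complexes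

A finite complex `K` is an `AbstractSimplicialComplex V` over its (finite) vertex set `V`. -/

/-- The set `S_i(K)` of `i`-faces: the faces with `i + 1` vertices. -/
abbrev Face {V : Type*} (K : AbstractSimplicialComplex V) (i : ℕ) : Type _ :=
  {F : Finset V // F ∈ K ∧ F.card = i + 1}

instance instFintypeFace {V : Type*} [Finite V] (K : AbstractSimplicialComplex V) (i : ℕ) :
    Fintype (Face K i) := Fintype.ofFinite _

/-- The `1`-skeleton of `K` as a simple graph. -/
def oneSkeleton {V : Type*} [DecidableEq V] (K : AbstractSimplicialComplex V) :
    SimpleGraph V where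
  Adj u v := u ≠ v ∧ ({u, v} : Finset V) ∈ K
  symm := ⟨fun u v h => ⟨h.1.symm, by rw [Finset.pair_comm]; exact h.2⟩⟩
  loopless := ⟨fun _ h => h.1 rfl⟩

/-! ### Orientations, coboundary matrices and up Laplacians -/

/-- A choice of an orientation `[F]` of every face `F` of `K`, given by an ordering
`v_0, …, v_i` of its vertices. -/
def FaceOrientation {V : Type*} (K : AbstractSimplicialComplex V) : Type _ :=
  ∀ (i : ℕ) (F : Face K i), Fin (i + 1) ≃ F.1

/-- The ordered list of vertices `v_0, …, v_i` which defines `[F]`. -/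
def FaceOrientation.list {V : Type*} {K : AbstractSimplicialComplex V} (o : FaceOrientation K)
    {i : ℕ} (F : Face K i) : Fin (i + 1) → V :=
  fun j => (o i F j : V)

/-- The sign of the ordered simplex `b` relative to the ordered simplex `a`
(both without repeated vertices): `1` if `b` is an even rearrangement of `a`,
`-1` if it is an odd one, and `0` if `b` is not a rearrangement of `a`. -/
def orientSign {V : Type*} [DecidableEq V] {n : ℕ} (a b : Fin n → V) : ℤ :=
  ∑ σ : Equiv.Perm (Fin n), if b = a ∘ σ then (Equiv.Perm.sign σ : ℤ) else 0

/-- `sgn([F], ∂[F'])`: the coefficient of the oriented simplex `a = [F]` in the boundary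
`∑ j, (-1)^j [b_0, …, b̂_j, …, b_n]` of the oriented simplex `b = [F']`. -/
def boundarySign {V : Type*} [DecidableEq V] {n : ℕ} (a : Fin n → V) (b : Fin (n + 1) → V) : ℤ :=
  ∑ j : Fin (n + 1), (-1) ^ (j : ℕ) * orientSign a (b ∘ j.succAbove)

/-- The matrix `D_i(K)` of the coboundary map `δ_i` in the bases of elementary cochains. -/
def coboundaryMatrix {V : Type*} [DecidableEq V] {K : AbstractSimplicialComplex V}
    (o : FaceOrientation K) (i : ℕ) : Matrix (Face K (i + 1)) (Face K i) ℝ :=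
  Matrix.of fun F' F => (boundarySign (o.list F) (o.list F') : ℝ)

/-- The diagonal matrix `W_i(K)` of the weights of the `i`-faces. -/
def weightMatrix {V : Type*} [DecidableEq V] (K : AbstractSimplicialComplex V)
    (w : Finset V → ℝ) (i : ℕ) : Matrix (Face K i) (Face K i) ℝ :=
  Matrix.diagonal fun F => w F.1

/-- The matrix `W_i⁻¹ D_iᵀ W_{i+1}` of the adjoint `δ_i^*` with respect to the weighted
inner products `⟨f, g⟩ = ∑ F, w F * f [F] * g [F]`. -/
def coboundaryAdjointMatrix {V : Type*} [Finite V] [DecidableEq V]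
    {K : AbstractSimplicialComplex V} (o : FaceOrientation K) (w : Finset V → ℝ) (i : ℕ) :
    Matrix (Face K i) (Face K (i + 1)) ℝ :=
  (weightMatrix K w i)⁻¹ * (coboundaryMatrix o i)ᵀ * weightMatrix K w (i + 1)

/-- The matrix of the `i`-up Laplace operator `δ_i^* δ_i`. -/
def upLaplacian {V : Type*} [Finite V] [DecidableEq V] {K : AbstractSimplicialComplex V}
    (o : FaceOrientation K) (w : Finset V → ℝ) (i : ℕ) : Matrix (Face K i) (Face K i) ℝ :=
  coboundaryAdjointMatrix o w i * coboundaryMatrix o i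

/-! ### Coverings -/

/-- `φ : V(K) → V(M)` is a simplicial map. -/
def IsSimplicialMap {V U : Type*} [DecidableEq U] (K : AbstractSimplicialComplex V)
    (M : AbstractSimplicialComplex U) (φ : V → U) : Prop :=
  ∀ F ∈ K, F.image φ ∈ M

/-- `φ : K → M` is a covering map: `K` is connected, `φ` is simplicial, and for every face `G`
of `M` the preimage `φ⁻¹(G)` is a union of pairwise disjoint simplices of `K`, each of which is
mapped bijectively onto `G`. -/
structure IsCovering {V U : Type*} [DecidableEq V] [DecidableEq U]
    (K : AbstractSimplicialComplex V) (M : AbstractSimplicialComplex U) (φ : V → U) : Prop where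
  connected : (oneSkeleton K).Connected
  simplicial : IsSimplicialMap K M φ
  bijOn : ∀ G ∈ M, ∀ F ∈ K, F.image φ = G → Set.BijOn φ F G
  disjoint : ∀ G ∈ M, {F | F ∈ K ∧ F.image φ = G}.PairwiseDisjoint id
  covers : ∀ G ∈ M, ∀ v, φ v ∈ G → ∃ F ∈ K, F.image φ = G ∧ v ∈ F

/-- A strong covering: if `G ∈ S_i(M)` is a face of `G' ∈ S_{i+1}(M)`, then every face `F` of `K`
over `G` is a face of some `F' ∈ S_{i+1}(K)` over `G'`. -/
structure IsStrongCovering {V U : Type*} [DecidableEq V] [DecidableEq U]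
    (K : AbstractSimplicialComplex V) (M : AbstractSimplicialComplex U) (φ : V → U) : Prop
    extends IsCovering K M φ where
  lift : ∀ (i : ℕ) (G : Face M i) (G' : Face M (i + 1)), G.1 ⊆ G'.1 →
    ∀ F : Face K i, F.1.image φ = G.1 →
      ∃ F' : Face K (i + 1), F.1 ⊆ F'.1 ∧ F'.1.image φ = G'.1

/-- A `k`-fold (strong) covering: over every `i`-face of `M` there are exactly `k` faces
of dimension `i` of `K`. -/
structure IsFoldCovering {V U : Type*} [DecidableEq V] [DecidableEq U] (k : ℕ)
    (K : AbstractSimplicialComplex V) (M : AbstractSimplicialComplex U) (φ : V → U) : Prop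
    extends IsStrongCovering K M φ where
  degree : ∀ (i : ℕ) (G : Face M i), Nat.card {F : Face K i // F.1.image φ = G.1} = k

/-! ### Incidence graphs, permutation voltages and derived graphs -/

/-- The `i`-th incidence graph `B_i(K)`, with vertex set `S_i(K) ∪ S_{i+1}(K)`. -/
def incidenceGraph {V : Type*} (K : AbstractSimplicialComplex V) (i : ℕ) :
    SimpleGraph (Face K i ⊕ Face K (i + 1)) where
  Adj
    | .inl F, .inr F' => F.1 ⊆ F'.1
    | .inr F', .inl F => F.1 ⊆ F'.1
    | _, _ => False
  symm := ⟨by rintro (F | F) (F' | F') h <;> exact h⟩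
  loopless := ⟨by rintro (F | F) h <;> exact h⟩

/-- A permutation voltage assignment on a simple graph: a permutation of `[k]` for every arc,
with `ψ(e⁻¹) = ψ(e)⁻¹`. -/
structure PermVoltage {X : Type*} (G : SimpleGraph X) (k : ℕ) where
  perm : G.Dart → Equiv.Perm (Fin k)
  perm_symm : ∀ d, perm d.symm = (perm d)⁻¹

/-- The derived graph `G^ψ` on `X × [k]`: the vertices `(u, a)` and `(v, b)` are adjacent
iff `u` and `v` are and `a = ψ(u, v)(b)`. -/
def derivedGraph {X : Type*} {G : SimpleGraph X} {k : ℕ} (ψ : PermVoltage G k) :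
    SimpleGraph (X × Fin k) where
  Adj x y := ∃ h : G.Adj x.1 y.1, x.2 = ψ.perm ⟨(x.1, y.1), h⟩ y.2
  symm := ⟨by
    rintro x y ⟨h, e⟩
    refine ⟨h.symm, ?_⟩
    have := ψ.perm_symm ⟨(x.1, y.1), h⟩
    change ψ.perm ⟨(y.1, x.1), h.symm⟩ = _ at this
    simp [this, e]⟩
  loopless := ⟨fun _ h => G.loopless.irrefl _ h.1⟩

/-- An isomorphism `η : B_i(M)^ψ → B_i(K)` which maps `S_i(M) × [k]` to `S_i(K)` and
`S_{i+1}(M) × [k]` to `S_{i+1}(K)`, and is compatible with the covering map: `φ η = p`, where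
`p` is the projection of `B_i(M)^ψ` to `B_i(M)`. -/
structure DerivedIso {V U : Type*} [DecidableEq U] (K : AbstractSimplicialComplex V)
    (M : AbstractSimplicialComplex U) (φ : V → U) {i k : ℕ}
    (ψ : PermVoltage (incidenceGraph M i) k) where
  iso : derivedGraph ψ ≃g incidenceGraph K i
  isLeft : ∀ (G : Face M i) (a : Fin k), (iso (.inl G, a)).isLeft
  isRight : ∀ (G' : Face M (i + 1)) (a : Fin k), (iso (.inr G', a)).isRight
  proj_left : ∀ (G : Face M i) (a : Fin k),
    ((iso (.inl G, a)).getLeft (isLeft G a)).1.image φ = G.1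
  proj_right : ∀ (G' : Face M (i + 1)) (a : Fin k),
    ((iso (.inr G', a)).getRight (isRight G' a)).1.image φ = G'.1

/-- The restriction `S_i(M) × [k] → S_i(K)` of `η`. -/
def DerivedIso.lower {V U : Type*} [DecidableEq U] {K : AbstractSimplicialComplex V}
    {M : AbstractSimplicialComplex U} {φ : V → U} {i k : ℕ}
    {ψ : PermVoltage (incidenceGraph M i) k} (η : DerivedIso K M φ ψ)
    (x : Face M i × Fin k) : Face K i :=
  (η.iso (.inl x.1, x.2)).getLeft (η.isLeft x.1 x.2)

/-- The signature matrix `Λ_i(M)^η`: its entry at `(G, a)` is the sign of the image under `φ` of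
the oriented face `[η(G, a)]` relative to `[G]`. -/
def signature {V U : Type*} [DecidableEq U] {K : AbstractSimplicialComplex V}
    {M : AbstractSimplicialComplex U} {φ : V → U} {i k : ℕ}
    {ψ : PermVoltage (incidenceGraph M i) k} (oK : FaceOrientation K) (oM : FaceOrientation M)
    (η : DerivedIso K M φ ψ) : Matrix (Face M i × Fin k) (Face M i × Fin k) ℝ :=
  Matrix.diagonal fun x => (orientSign (oM.list x.1) (φ ∘ oK.list (η.lower x)) : ℝ)

/-! ### The voltage group and its permutation representation -/

/-- The group `Ψ_i` generated by the permutations which `ψ` assigns to the incidences of `M`. -/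
def voltageGroup {U : Type*} {M : AbstractSimplicialComplex U} {i k : ℕ}
    (ψ : PermVoltage (incidenceGraph M i) k) : Subgroup (Equiv.Perm (Fin k)) :=
  Subgroup.closure {g | ∃ (G : Face M i) (G' : Face M (i + 1))
    (h : (incidenceGraph M i).Adj (.inl G) (.inr G')), ψ.perm ⟨(.inl G, .inr G'), h⟩ = g}

instance instFintypeVoltageGroup {U : Type*} {M : AbstractSimplicialComplex U} {i k : ℕ}
    (ψ : PermVoltage (incidenceGraph M i) k) : Fintype (voltageGroup ψ) := Fintype.ofFinite _

open Classical in
/-- The matrix `D_i^g(M)`: the entries of `D_i(M)` at the incidences `(G', G)` with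
`ψ(G', G) = g`, and `0` elsewhere. -/
def coboundaryPart {U : Type*} [DecidableEq U] {M : AbstractSimplicialComplex U} {i k : ℕ}
    (o : FaceOrientation M) (ψ : PermVoltage (incidenceGraph M i) k) (g : Equiv.Perm (Fin k)) :
    Matrix (Face M (i + 1)) (Face M i) ℝ :=
  Matrix.of fun G' G =>
    if ∃ h : (incidenceGraph M i).Adj (.inr G') (.inl G), ψ.perm ⟨(.inr G', .inl G), h⟩ = g
    then coboundaryMatrix o i G' G else 0

/-- The permutation matrix `P^g`: its `(a, b)` entry is `1` iff `a = g b`. -/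
def permutationMatrix {k : ℕ} (g : Equiv.Perm (Fin k)) : Matrix (Fin k) (Fin k) ℂ :=
  Matrix.of fun a b => if a = g b then 1 else 0

/-- The linear representation on `ℂ^d` given by a matrix representation. -/
def matrixRep {Γ : Type*} [Group Γ] {d : ℕ} (ρ : Γ →* Matrix (Fin d) (Fin d) ℂ) :
    Representation ℂ Γ (Fin d → ℂ) :=
  (Matrix.toLinAlgEquiv' : Matrix (Fin d) (Fin d) ℂ ≃ₐ[ℂ] _).toAlgHom.toMonoidHom.comp ρ

/-! ### Matrices over `ℂ` and direct sums -/

/-- A real matrix regarded as a complex matrix. -/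
abbrev toComplex {X Y : Type*} (A : Matrix X Y ℝ) : Matrix X Y ℂ := A.map Complex.ofReal

/-- The direct sum `A ⊕ B_1 ⊕ ⋯ ⊕ B_m` of square matrices. -/
def directSum {m : ℕ} {X : Type*} {Y : Fin m → Type*} (A : Matrix X X ℂ)
    (B : ∀ j, Matrix (Y j) (Y j) ℂ) : Matrix (X ⊕ Σ j, Y j) (X ⊕ Σ j, Y j) ℂ :=
  Matrix.fromBlocks A 0 0 (Matrix.blockDiagonal' B)

/-- The relabelling of the rows and columns of `A ⊗ (I_1 ⊕ B_1 ⊕ ⋯ ⊕ B_m)`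
which displays it as `A ⊕ (A ⊗ B_1) ⊕ ⋯ ⊕ (A ⊗ B_m)`; `e` identifies `[k]` with the
index set of `I_1 ⊕ B_1 ⊕ ⋯ ⊕ B_m`. -/
def blockEquiv {k m : ℕ} {d : Fin m → ℕ} (X : Type*) (e : Fin k ≃ Unit ⊕ Σ j, Fin (d j)) :
    X × Fin k ≃ X ⊕ Σ j, X × Fin (d j) where
  toFun x := match e x.2 with
    | .inl _ => .inl x.1
    | .inr ⟨j, a⟩ => .inr ⟨j, (x.1, a)⟩
  invFun
    | .inl x => (x, e.symm (.inl ()))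
    | .inr ⟨j, (x, a)⟩ => (x, e.symm (.inr ⟨j, a⟩))
  left_inv := by
    rintro ⟨x, a⟩
    obtain ⟨s, rfl⟩ := e.symm.surjective a
    rcases s with _ | ⟨j, b⟩ <;> simp
  right_inv := by
    rintro (x | ⟨j, x, b⟩) <;> simp

end CoveringComplex

end

open CoveringComplex

namespace CoveringComplex

open Matrix

/-! ### Orientation and boundary signs as determinants -/

/-! Everything follows from factoring the up Laplacian and lifting each factor through the covering.
Label the faces of `K` by `η` and compare their orientations with those pulled back from `M`. On
incident pairs, after multiplication by the relative signs of both faces, an entry of `D_i(K)`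
becomes the corresponding entry of `D_i(M)` (`relativeSign_mul_boundarySign`). Incidence in `K` is
adjacency in the derived graph, so the lifted matrix is `∑ D_i^g ⊗ P^g`.

In the Laplacian every `(i+1)`-face contributes two coboundary entries, so its relative sign is
squared and disappears; only the signs of the `i`-faces remain, and these form `Λ`. Since weights
are pulled back from `M` and `P^(g⁻¹)` is the transpose of `P^g`, `Λ L Λ` is the product of `∑ W_i⁻¹
(D_i^g)ᵀ ⊗ P^(g⁻¹)` and `∑ W_{i+1} D_i^g ⊗ P^g` (`signature_conj_upLaplacian`).

Inserting `I ⊗ T` and its inverse between the factors turns each `P^g` into `T⁻¹ P^g T`, so both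
factors split into blocks simultaneously. In the trivial block the parts `D_i^g` add up to `D_i(M)`,
which gives the Laplacian of `M`; the other blocks are the stated products. -/

/-- The `0`-`1` matrix of coincidences between the entries of two lists. -/
def incidenceMatrix {V : Type*} [DecidableEq V] {m n : ℕ} (a : Fin m → V) (b : Fin n → V) :
    Matrix (Fin m) (Fin n) ℤ :=
  Matrix.of fun p q => if b q = a p then 1 else 0

/-- This is the Leibniz expansion: the product of the coincidence indicators along `σ` is the
indicator of `b = a ∘ σ`. -/
theorem orientSign_eq_det {V : Type*} [DecidableEq V] {n : ℕ} (a b : Fin n → V) :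
    orientSign a b = (incidenceMatrix a b).det := by
  rw [orientSign, Matrix.det_apply']
  refine Finset.sum_congr rfl fun σ _ => ?_
  simp [incidenceMatrix, Finset.prod_boole, funext_iff]

theorem orientSign_comp_self {V : Type*} [DecidableEq V] {n : ℕ} {a : Fin n → V}
    (ha : Function.Injective a) (σ : Equiv.Perm (Fin n)) :
    orientSign a (a ∘ σ) = Equiv.Perm.sign σ := by
  rw [orientSign, Finset.sum_eq_single σ]
  · simp
  · intro τ _ hτ
    rw [if_neg]
    exact fun h => hτ (Equiv.ext fun x => ha (congrFun h x).symm)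
  · simp

/-- The matrix of coincidences of two lists, with a row of ones added on top. -/
def augmentedIncidenceMatrix {V : Type*} [DecidableEq V] {n : ℕ} (a : Fin n → V)
    (b : Fin (n + 1) → V) : Matrix (Fin (n + 1)) (Fin (n + 1)) ℤ :=
  Matrix.of fun p q => Fin.cases 1 (fun p => incidenceMatrix a b p q) p

/-- Laplace expansion along the row of ones: deleting that row and column `j` leaves the coincidence
matrix of `a` and `b` without `b_j`. Reordering `b`, which scrambles the terms of the alternating
sum, thus becomes a mere column permutation. -/
theorem boundarySign_eq_det {V : Type*} [DecidableEq V] {n : ℕ} (a : Fin n → V)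
    (b : Fin (n + 1) → V) :
    boundarySign a b = (augmentedIncidenceMatrix a b).det := by
  rw [Matrix.det_succ_row_zero, boundarySign]
  refine Finset.sum_congr rfl fun j _ => ?_
  rw [orientSign_eq_det, show augmentedIncidenceMatrix a b 0 j = 1 from rfl, mul_one]
  rfl

theorem boundarySign_comp_right {V : Type*} [DecidableEq V] {n : ℕ} (a : Fin n → V)
    (b : Fin (n + 1) → V) (τ : Equiv.Perm (Fin (n + 1))) :
    boundarySign a (b ∘ τ) = Equiv.Perm.sign τ * boundarySign a b := by
  rw [boundarySign_eq_det, boundarySign_eq_det, ← Int.cast_id (n := (Equiv.Perm.sign τ : ℤ)),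
    ← Matrix.det_permute']
  rfl

theorem orientSign_comp_left {V : Type*} [DecidableEq V] {n : ℕ} (a b : Fin n → V)
    (σ : Equiv.Perm (Fin n)) :
    orientSign (a ∘ σ) b = Equiv.Perm.sign σ * orientSign a b := by
  rw [orientSign_eq_det, orientSign_eq_det, ← Int.cast_id (n := (Equiv.Perm.sign σ : ℤ)),
    ← Matrix.det_permute]
  rfl

theorem boundarySign_comp_left {V : Type*} [DecidableEq V] {n : ℕ} (a : Fin n → V)
    (b : Fin (n + 1) → V) (σ : Equiv.Perm (Fin n)) :
    boundarySign (a ∘ σ) b = Equiv.Perm.sign σ * boundarySign a b := by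
  simp only [boundarySign, orientSign_comp_left, Finset.mul_sum]
  exact Finset.sum_congr rfl fun j _ => by ring

/-- An entry of `a` that is missing from `b` produces a zero row in the determinant. -/
theorem range_subset_of_boundarySign_ne_zero {V : Type*} [DecidableEq V] {n : ℕ} {a : Fin n → V}
    {b : Fin (n + 1) → V} (h : boundarySign a b ≠ 0) : Set.range a ⊆ Set.range b := by
  rintro _ ⟨p, rfl⟩
  by_contra hp
  refine h ?_
  rw [boundarySign_eq_det]
  refine Matrix.det_eq_zero_of_row_eq_zero p.succ fun q => ?_
  exact if_neg fun hq => hp ⟨q, hq⟩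

/-- The determinant sees only which entries coincide, and a map injective on `s` preserves this. -/
theorem boundarySign_map {V U : Type*} [DecidableEq V] [DecidableEq U] {n : ℕ} {a : Fin n → V}
    {b : Fin (n + 1) → V} {φ : V → U} {s : Set V} (hφ : Set.InjOn φ s)
    (ha : ∀ p, a p ∈ s) (hb : ∀ q, b q ∈ s) :
    boundarySign (φ ∘ a) (φ ∘ b) = boundarySign a b := by
  rw [boundarySign_eq_det, boundarySign_eq_det]
  congr 1
  ext p q
  refine Fin.cases rfl (fun p => ?_) p
  simp [augmentedIncidenceMatrix, incidenceMatrix, hφ.eq_iff (hb q) (ha p)]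

/-! ### Oriented faces -/

section Faces

variable {V U : Type*} {K : AbstractSimplicialComplex V} {M : AbstractSimplicialComplex U}

theorem FaceOrientation.list_injective (o : FaceOrientation K) {i : ℕ} (F : Face K i) :
    Function.Injective (o.list F) :=
  Subtype.val_injective.comp (o i F).injective

theorem FaceOrientation.range_list (o : FaceOrientation K) {i : ℕ} (F : Face K i) :
    Set.range (o.list F) = F.1 := by
  ext v
  constructor
  · rintro ⟨p, rfl⟩
    exact (o i F p).2
  · intro hv
    exact ⟨(o i F).symm ⟨v, hv⟩, by simp [FaceOrientation.list]⟩

theorem FaceOrientation.list_mem (o : FaceOrientation K) {i : ℕ} (F : Face K i)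
    (p : Fin (i + 1)) : o.list F p ∈ F.1 :=
  (o i F p).2

theorem coboundaryMatrix_eq_zero [DecidableEq V] (o : FaceOrientation K) {i : ℕ}
    {F' : Face K (i + 1)} {F : Face K i} (h : ¬ F.1 ⊆ F'.1) : coboundaryMatrix o i F' F = 0 := by
  by_contra hne
  refine h ?_
  have h1 : boundarySign (o.list F) (o.list F') ≠ 0 := fun h0 => hne (by
    simp [coboundaryMatrix, h0])
  have h2 := range_subset_of_boundarySign_ne_zero h1
  rwa [o.range_list, o.range_list, Finset.coe_subset] at h2

theorem injOn_of_card_image [DecidableEq U] {φ : V → U} {i : ℕ} {F : Face K i} {G : Face M i}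
    (h : F.1.image φ = G.1) : Set.InjOn φ F.1 := by
  rw [← Finset.card_image_iff, h, G.2.2, F.2.2]

theorem exists_perm_of_image_eq [DecidableEq U] {φ : V → U} {i : ℕ} {F : Face K i} {G : Face M i}
    (oK : FaceOrientation K) (oM : FaceOrientation M) (h : F.1.image φ = G.1) :
    ∃ σ : Equiv.Perm (Fin (i + 1)), φ ∘ oK.list F = oM.list G ∘ σ := by
  have hmem : ∀ p, φ (oK.list F p) ∈ G.1 := fun p =>
    h ▸ Finset.mem_image_of_mem φ (oK.list_mem F p)
  let f : Fin (i + 1) → Fin (i + 1) := fun p => (oM i G).symm ⟨_, hmem p⟩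
  have hf : Function.Injective f := fun p q hpq => by
    have h1 := congrArg Subtype.val ((oM i G).symm.injective hpq)
    exact oK.list_injective F
      (injOn_of_card_image h (oK.list_mem F p) (oK.list_mem F q) h1)
  refine ⟨Equiv.ofBijective f (Finite.injective_iff_bijective.mp hf), funext fun p => ?_⟩
  simp [f, FaceOrientation.list]

/-- The sign of the image under `φ` of the oriented face `[F]` relative to `[G]`. -/
def relativeSign [DecidableEq U] (oK : FaceOrientation K) (oM : FaceOrientation M) (φ : V → U)
    {i : ℕ} (F : Face K i) (G : Face M i) : ℤ :=
  orientSign (oM.list G) (φ ∘ oK.list F)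

theorem relativeSign_mul_self [DecidableEq U] {φ : V → U} {i : ℕ} {F : Face K i} {G : Face M i}
    (oK : FaceOrientation K) (oM : FaceOrientation M) (h : F.1.image φ = G.1) :
    relativeSign oK oM φ F G * relativeSign oK oM φ F G = 1 := by
  obtain ⟨σ, hσ⟩ := exists_perm_of_image_eq oK oM h
  rw [relativeSign, hσ, orientSign_comp_self (oM.list_injective G)]
  exact Int.units_coe_mul_self _

/-- The images of `[F]` and `[F']` are reorderings of `[G]` and `[G']` by permutations `σ` and `τ`.
They change the boundary sign by `sign σ * sign τ`, which is exactly the product of the two relative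
signs. -/
theorem relativeSign_mul_boundarySign [DecidableEq V] [DecidableEq U] {φ : V → U} {i : ℕ}
    {F : Face K i} {G : Face M i} {F' : Face K (i + 1)} {G' : Face M (i + 1)}
    (oK : FaceOrientation K) (oM : FaceOrientation M) (h : F.1.image φ = G.1)
    (h' : F'.1.image φ = G'.1) (hF : F.1 ⊆ F'.1) :
    relativeSign oK oM φ F' G' * boundarySign (oK.list F) (oK.list F')
      * relativeSign oK oM φ F G = boundarySign (oM.list G) (oM.list G') := by
  obtain ⟨σ, hσ⟩ := exists_perm_of_image_eq oK oM h
  obtain ⟨τ, hτ⟩ := exists_perm_of_image_eq oK oM h'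
  rw [← boundarySign_map (injOn_of_card_image h') (fun p => hF (oK.list_mem F p))
    (oK.list_mem F'), relativeSign, relativeSign, hσ, hτ,
    orientSign_comp_self (oM.list_injective G), orientSign_comp_self (oM.list_injective G'),
    boundarySign_comp_left, boundarySign_comp_right]
  have h1 := Int.units_coe_mul_self (Equiv.Perm.sign σ)
  have h2 := Int.units_coe_mul_self (Equiv.Perm.sign τ)
  linear_combination (boundarySign (oM.list G) (oM.list G')) *
    ((Equiv.Perm.sign τ : ℤ) * (Equiv.Perm.sign τ : ℤ) * h1 + h2)

end Faces

/-! ### The isomorphism of the derived graph with the incidence graph -/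

section DerivedIso

variable {V U : Type*} [DecidableEq U] {K : AbstractSimplicialComplex V}
  {M : AbstractSimplicialComplex U} {φ : V → U} {i k : ℕ}
  {ψ : PermVoltage (incidenceGraph M i) k} (η : DerivedIso K M φ ψ)

/-- The restriction `S_{i+1}(M) × [k] → S_{i+1}(K)` of `η`. -/
def DerivedIso.upper (x : Face M (i + 1) × Fin k) : Face K (i + 1) :=
  (η.iso (.inr x.1, x.2)).getRight (η.isRight x.1 x.2)

theorem DerivedIso.iso_inl (x : Face M i × Fin k) : η.iso (.inl x.1, x.2) = .inl (η.lower x) := by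
  simp [DerivedIso.lower]

theorem DerivedIso.iso_inr (x : Face M (i + 1) × Fin k) :
    η.iso (.inr x.1, x.2) = .inr (η.upper x) := by
  simp [DerivedIso.upper]

/-- Allows the sum over the `(i+1)`-faces of `K` inside the Laplacian to be reindexed. Surjectivity
holds because a preimage in the lower layer would be sent to an `i`-face. -/
theorem DerivedIso.upper_bijective : Function.Bijective η.upper := by
  constructor
  · intro x y h
    have := η.iso.injective (((η.iso_inr x).trans (by rw [h])).trans (η.iso_inr y).symm)
    simpa [Prod.ext_iff] using this
  · intro F
    obtain ⟨⟨G | G, a⟩, hx⟩ := η.iso.surjective (.inr F)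
    · have := η.iso_inl (G, a)
      simp [hx] at this
    · exact ⟨(G, a), Sum.inr_injective ((η.iso_inr (G, a)).symm.trans hx)⟩

theorem DerivedIso.lower_subset_upper_iff (x : Face M i × Fin k) (y : Face M (i + 1) × Fin k) :
    (η.lower x).1 ⊆ (η.upper y).1 ↔
      ∃ h : (incidenceGraph M i).Adj (.inr y.1) (.inl x.1),
        y.2 = ψ.perm ⟨(.inr y.1, .inl x.1), h⟩ x.2 := by
  have h := η.iso.map_rel_iff (a := (.inr y.1, y.2)) (b := (.inl x.1, x.2))
  rw [η.iso_inl, η.iso_inr] at h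
  exact h

variable (oK : FaceOrientation K) (oM : FaceOrientation M)

theorem signature_mul_self [Finite U] : signature oK oM η * signature oK oM η = 1 := by
  rw [signature, Matrix.diagonal_mul_diagonal, ← Matrix.diagonal_one]
  congr 1
  funext x
  exact_mod_cast relativeSign_mul_self oK oM (η.proj_left x.1 x.2)

open Classical in
/-- The coboundary matrix of `K` in the labels given by `η`, for the orientations lifted from
`M`. -/
noncomputable def liftedCoboundary (oM : FaceOrientation M) (ψ : PermVoltage (incidenceGraph M i) k) :
    Matrix (Face M (i + 1) × Fin k) (Face M i × Fin k) ℝ :=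
  Matrix.of fun y x =>
    if ∃ h : (incidenceGraph M i).Adj (.inr y.1) (.inl x.1),
      y.2 = ψ.perm ⟨(.inr y.1, .inl x.1), h⟩ x.2
    then coboundaryMatrix oM i y.1 x.1 else 0

theorem relativeSign_mul_coboundaryMatrix [DecidableEq V] (x : Face M i × Fin k) (y : Face M (i + 1) × Fin k) :
    (relativeSign oK oM φ (η.upper y) y.1 : ℝ) * coboundaryMatrix oK i (η.upper y) (η.lower x)
      * (relativeSign oK oM φ (η.lower x) x.1 : ℝ) = liftedCoboundary oM ψ y x := by
  rw [liftedCoboundary, Matrix.of_apply]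
  split_ifs with h <;> rw [← η.lower_subset_upper_iff] at h
  · rw [coboundaryMatrix, coboundaryMatrix, Matrix.of_apply, Matrix.of_apply]
    exact_mod_cast relativeSign_mul_boundarySign oK oM (η.proj_left x.1 x.2)
      (η.proj_right y.1 y.2) h
  · rw [coboundaryMatrix_eq_zero oK h, mul_zero, zero_mul]

end DerivedIso

/-! ### Laplacians -/

theorem weightMatrix_inv {V : Type*} [Finite V] [DecidableEq V] (K : AbstractSimplicialComplex V)
    {w : Finset V → ℝ} (hw : ∀ F ∈ K, 0 < w F) (i : ℕ) :
    (weightMatrix K w i)⁻¹ = Matrix.diagonal fun F => (w F.1)⁻¹ := by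
  refine Matrix.inv_eq_left_inv ?_
  rw [weightMatrix, Matrix.diagonal_mul_diagonal, ← Matrix.diagonal_one]
  congr 1
  funext F
  exact inv_mul_cancel₀ (hw F.1 F.2.1).ne'

theorem upLaplacian_apply {V : Type*} [Finite V] [DecidableEq V]
    {K : AbstractSimplicialComplex V} (o : FaceOrientation K) {w : Finset V → ℝ}
    (hw : ∀ F ∈ K, 0 < w F) (i : ℕ) (F₁ F₂ : Face K i) :
    upLaplacian o w i F₁ F₂ = ∑ F' : Face K (i + 1),
      (w F₁.1)⁻¹ * coboundaryMatrix o i F' F₁ * w F'.1 * coboundaryMatrix o i F' F₂ := by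
  rw [upLaplacian, Matrix.mul_apply]
  refine Finset.sum_congr rfl fun F' _ => ?_
  rw [coboundaryAdjointMatrix, weightMatrix_inv K hw, weightMatrix, Matrix.mul_diagonal,
    Matrix.diagonal_mul, Matrix.transpose_apply]

section Lift

variable {V U : Type*} [Finite V] [Finite U] [DecidableEq V] [DecidableEq U]
  {K : AbstractSimplicialComplex V}
  {M : AbstractSimplicialComplex U} {φ : V → U} {i k : ℕ}
  {ψ : PermVoltage (incidenceGraph M i) k} (η : DerivedIso K M φ ψ)
  (oK : FaceOrientation K) (oM : FaceOrientation M)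

/-- The signature supplies only the signs of the `i`-faces. The sign of each `(i+1)`-face, needed to
lift both coboundary entries, may be inserted for free because it occurs squared. -/
theorem signature_conj_upLaplacian {wK : Finset V → ℝ} {wM : Finset U → ℝ}
    (hwK : ∀ F ∈ K, 0 < wK F) (hw : ∀ F ∈ K, wK F = wM (F.image φ)) :
    signature oK oM η * (upLaplacian oK wK i).submatrix η.lower η.lower * signature oK oM η =
      (Matrix.of fun x y => (wM x.1.1)⁻¹ * liftedCoboundary oM ψ y x) *
        (Matrix.of fun y x => wM y.1.1 * liftedCoboundary oM ψ y x) := by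
  ext x z
  rw [signature, Matrix.mul_diagonal, Matrix.diagonal_mul, Matrix.submatrix_apply,
    upLaplacian_apply oK hwK, ← (Equiv.ofBijective _ η.upper_bijective).sum_comp,
    Finset.mul_sum, Finset.sum_mul, Matrix.mul_apply]
  refine Finset.sum_congr rfl fun y _ => ?_
  have hx : wK (η.lower x).1 = wM x.1.1 :=
    (hw _ (η.lower x).2.1).trans (congrArg wM (η.proj_left x.1 x.2))
  have hy : wK (η.upper y).1 = wM y.1.1 :=
    (hw _ (η.upper y).2.1).trans (congrArg wM (η.proj_right y.1 y.2))
  have hs : (relativeSign oK oM φ (η.upper y) y.1 : ℝ) * relativeSign oK oM φ (η.upper y) y.1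
      = 1 := by
    exact_mod_cast relativeSign_mul_self oK oM (η.proj_right y.1 y.2)
  rw [Matrix.of_apply, Matrix.of_apply, ← relativeSign_mul_coboundaryMatrix η oK oM x y,
    ← relativeSign_mul_coboundaryMatrix η oK oM z y, Equiv.ofBijective_apply, hx, hy]
  change (relativeSign oK oM φ (η.lower x) x.1 : ℝ) * _ *
    (relativeSign oK oM φ (η.lower z) z.1 : ℝ) = _
  -- The right side is the left side times the square of the upper sign, so the coefficient is minus
  -- the left side.
  linear_combination (-(relativeSign oK oM φ (η.lower x) x.1 : ℝ) * (wM x.1.1)⁻¹ *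
    coboundaryMatrix oK i (η.upper y) (η.lower x) * wM y.1.1 *
    coboundaryMatrix oK i (η.upper y) (η.lower z) *
    (relativeSign oK oM φ (η.lower z) z.1 : ℝ)) * hs

end Lift

/-! ### Decomposition along the voltage group -/

theorem permutationMatrix_inv_apply {k : ℕ} (g : Equiv.Perm (Fin k)) (a b : Fin k) :
    permutationMatrix g⁻¹ a b = permutationMatrix g b a := by
  simp only [permutationMatrix, Matrix.of_apply, Equiv.Perm.eq_inv_iff_eq, eq_comm]

section Voltage

variable {U : Type*} {M : AbstractSimplicialComplex U} {i k : ℕ}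
  (ψ : PermVoltage (incidenceGraph M i) k) (o : FaceOrientation M)

/-- The generators are the voltages of the arcs from `G` to `G'`; the opposite arc carries the
inverse. -/
theorem perm_mem_voltageGroup {G' : Face M (i + 1)} {G : Face M i}
    (h : (incidenceGraph M i).Adj (.inr G') (.inl G)) :
    ψ.perm ⟨(.inr G', .inl G), h⟩ ∈ voltageGroup ψ := by
  rw [← inv_mem_iff, ← ψ.perm_symm]
  exact Subgroup.subset_closure ⟨G, G', h.symm, rfl⟩

variable [DecidableEq U]

open Classical in
-- Each incidence carries a single voltage, so at most one `g` contributes. Constant `f` recovers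
-- `D_i(M)`, and `f` an entry of `P^g` gives the lifted coboundary matrix.
theorem sum_coboundaryPart_mul (f : voltageGroup ψ → ℂ) (G' : Face M (i + 1)) (G : Face M i) :
    ∑ g : voltageGroup ψ, (coboundaryPart o ψ (g : Equiv.Perm (Fin k)) G' G : ℂ) * f g =
      if h : (incidenceGraph M i).Adj (.inr G') (.inl G) then
        (coboundaryMatrix o i G' G : ℂ) * f ⟨_, perm_mem_voltageGroup ψ h⟩ else 0 := by
  split_ifs with h
  · rw [Finset.sum_eq_single ⟨_, perm_mem_voltageGroup ψ h⟩]
    · rw [coboundaryPart, Matrix.of_apply, if_pos ⟨h, rfl⟩]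
    · intro g _ hg
      rw [coboundaryPart, Matrix.of_apply, if_neg, Complex.ofReal_zero, zero_mul]
      rintro ⟨_, hg'⟩
      exact hg (Subtype.ext hg'.symm)
    · simp
  · refine Finset.sum_eq_zero fun g _ => ?_
    rw [coboundaryPart, Matrix.of_apply, if_neg, Complex.ofReal_zero, zero_mul]
    rintro ⟨h', _⟩
    exact h h'

theorem sum_coboundaryPart (G' : Face M (i + 1)) (G : Face M i) :
    ∑ g : voltageGroup ψ, (coboundaryPart o ψ (g : Equiv.Perm (Fin k)) G' G : ℂ) =
      coboundaryMatrix o i G' G := by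
  classical
  have h := sum_coboundaryPart_mul ψ o (fun _ => 1) G' G
  simp only [mul_one] at h
  rw [h]
  split_ifs with h'
  · rfl
  · rw [coboundaryMatrix_eq_zero o fun h'' => h' h'', Complex.ofReal_zero]

theorem sum_coboundaryPart_mul_permutationMatrix (y : Face M (i + 1) × Fin k)
    (x : Face M i × Fin k) :
    ∑ g : voltageGroup ψ, (coboundaryPart o ψ (g : Equiv.Perm (Fin k)) y.1 x.1 : ℂ) *
      permutationMatrix (g : Equiv.Perm (Fin k)) y.2 x.2 = liftedCoboundary o ψ y x := by
  classical
  rw [sum_coboundaryPart_mul ψ o (fun g => permutationMatrix (g : Equiv.Perm (Fin k)) y.2 x.2),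
    liftedCoboundary, Matrix.of_apply]
  by_cases h : (incidenceGraph M i).Adj (.inr y.1) (.inl x.1)
  · simp only [h, dif_pos, exists_true_left, permutationMatrix, Matrix.of_apply]
    split_ifs <;> simp
  · simp [h]

variable [Finite U] {w : Finset U → ℝ}

theorem sum_kronecker_permutationMatrix :
    ∑ g : voltageGroup ψ, toComplex (weightMatrix M w (i + 1) *
        coboundaryPart o ψ (g : Equiv.Perm (Fin k))) ⊗ₖ
        permutationMatrix (g : Equiv.Perm (Fin k)) =
      toComplex (Matrix.of fun y x => w y.1.1 * liftedCoboundary o ψ y x) := by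
  ext y x
  rw [Matrix.sum_apply, toComplex, Matrix.map_apply, Matrix.of_apply, Complex.ofReal_mul,
    ← sum_coboundaryPart_mul_permutationMatrix ψ o y x, Finset.mul_sum]
  refine Finset.sum_congr rfl fun g _ => ?_
  rw [Matrix.kronecker_apply, toComplex, Matrix.map_apply, weightMatrix, Matrix.diagonal_mul,
    Complex.ofReal_mul, mul_assoc]

/-- The inverse voltage is the effect of transposition: permutation matrices are orthogonal. -/
theorem sum_kronecker_permutationMatrix_inv (hw : ∀ G ∈ M, 0 < w G) :
    ∑ g : voltageGroup ψ, toComplex ((weightMatrix M w i)⁻¹ *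
        (coboundaryPart o ψ (g : Equiv.Perm (Fin k)))ᵀ) ⊗ₖ
        permutationMatrix ((g⁻¹ : voltageGroup ψ) : Equiv.Perm (Fin k)) =
      toComplex (Matrix.of fun x y => (w x.1.1)⁻¹ * liftedCoboundary o ψ y x) := by
  ext x y
  rw [Matrix.sum_apply, toComplex, Matrix.map_apply, Matrix.of_apply, Complex.ofReal_mul,
    ← sum_coboundaryPart_mul_permutationMatrix ψ o y x, Finset.mul_sum]
  refine Finset.sum_congr rfl fun g _ => ?_
  rw [Matrix.kronecker_apply, toComplex, Matrix.map_apply, weightMatrix_inv M hw, Matrix.diagonal_mul,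
    Complex.ofReal_mul, mul_assoc, Matrix.transpose_apply, InvMemClass.coe_inv,
    permutationMatrix_inv_apply]

theorem sum_weightMatrix_mul_coboundaryPart :
    ∑ g : voltageGroup ψ, toComplex (weightMatrix M w (i + 1) *
        coboundaryPart o ψ (g : Equiv.Perm (Fin k))) =
      toComplex (weightMatrix M w (i + 1) * coboundaryMatrix o i) := by
  ext y x
  simp only [Matrix.sum_apply, Matrix.map_apply, weightMatrix, Matrix.diagonal_mul,
    Complex.ofReal_mul, ← sum_coboundaryPart ψ o y x, Finset.mul_sum]

theorem sum_weightMatrix_inv_mul_coboundaryPart (hw : ∀ G ∈ M, 0 < w G) :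
    ∑ g : voltageGroup ψ, toComplex ((weightMatrix M w i)⁻¹ *
        (coboundaryPart o ψ (g : Equiv.Perm (Fin k)))ᵀ) =
      toComplex ((weightMatrix M w i)⁻¹ * (coboundaryMatrix o i)ᵀ) := by
  ext x y
  simp only [Matrix.sum_apply, Matrix.map_apply, weightMatrix_inv M hw, Matrix.diagonal_mul,
    Matrix.transpose_apply, Complex.ofReal_mul, ← sum_coboundaryPart ψ o y x, Finset.mul_sum]

end Voltage

/-! ### Block decomposition -/

theorem toComplex_mul {X Y Z : Type*} [Fintype Y] (A : Matrix X Y ℝ) (B : Matrix Y Z ℝ) :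
    toComplex (A * B) = toComplex A * toComplex B :=
  Matrix.map_mul (f := Complex.ofRealHom)

/-- The factors are rectangular, so the matrix inserted between them lives on the middle index set
and may differ in size from `R`. -/
theorem conj_mul_of_isUnit_det {X Y : Type*} [Fintype X] [Fintype Y] [DecidableEq X]
    [DecidableEq Y] {R : Matrix X X ℂ} {S : Matrix Y Y ℂ} (hS : IsUnit S.det)
    (A : Matrix X Y ℂ) (B : Matrix Y X ℂ) :
    R⁻¹ * (A * B) * R = (R⁻¹ * A * S) * (S⁻¹ * B * R) := by
  simp only [Matrix.mul_assoc, Matrix.mul_nonsing_inv_cancel_left _ _ hS]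

theorem kronecker_conj_sum {X Y ι : Type*} [Fintype X] [Fintype Y] [DecidableEq X] [DecidableEq Y]
    {k : ℕ} (s : Finset ι) (A : ι → Matrix X Y ℂ) (P : ι → Matrix (Fin k) (Fin k) ℂ)
    (T : Matrix (Fin k) (Fin k) ℂ) :
    ((1 : Matrix X X ℂ) ⊗ₖ T)⁻¹ * (∑ g ∈ s, A g ⊗ₖ P g) * ((1 : Matrix Y Y ℂ) ⊗ₖ T) =
      ∑ g ∈ s, A g ⊗ₖ (T⁻¹ * P g * T) := by
  rw [Matrix.inv_kronecker, inv_one, Matrix.mul_sum, Matrix.sum_mul]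
  refine Finset.sum_congr rfl fun g _ => ?_
  rw [← Matrix.mul_kronecker_mul, ← Matrix.mul_kronecker_mul, Matrix.one_mul, Matrix.mul_one]

/-- The Kronecker product distributes over a direct sum in its second factor; the trivial `1 × 1`
block leaves the plain sum of the `A g`. Rows and columns are relabelled separately since `A g` may
be rectangular. -/
theorem sum_kronecker_directSum {X Y ι : Type*} {k m : ℕ} {d : Fin m → ℕ}
    (e : Fin k ≃ Unit ⊕ Σ j, Fin (d j)) (s : Finset ι) (A : ι → Matrix X Y ℂ)
    (B : ∀ j, ι → Matrix (Fin (d j)) (Fin (d j)) ℂ) :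
    ∑ g ∈ s, A g ⊗ₖ (directSum (1 : Matrix Unit Unit ℂ) fun j => B j g).submatrix e e =
      (Matrix.fromBlocks (∑ g ∈ s, A g) 0 0
        (Matrix.blockDiagonal' fun j => ∑ g ∈ s, A g ⊗ₖ B j g)).submatrix
          (blockEquiv X e) (blockEquiv Y e) := by
  ext ⟨x, a⟩ ⟨y, b⟩
  obtain ⟨a, rfl⟩ := e.symm.surjective a
  obtain ⟨b, rfl⟩ := e.symm.surjective b
  rcases a with a | ⟨j, a⟩ <;> rcases b with b | ⟨l, b⟩
  · simp [Matrix.sum_apply, directSum, blockEquiv]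
  · simp [Matrix.sum_apply, directSum, blockEquiv]
  · simp [Matrix.sum_apply, directSum, blockEquiv]
  · by_cases h : j = l
    · subst h
      simp [Matrix.sum_apply, directSum, blockEquiv, Matrix.blockDiagonal'_apply]
    · simp [Matrix.sum_apply, directSum, blockEquiv, Matrix.blockDiagonal'_apply, h]

end CoveringComplex

theorem theorem1p4
    {V U : Type*} [Fintype V] [DecidableEq V] [Fintype U] [DecidableEq U]
    {K : AbstractSimplicialComplex V} {M : AbstractSimplicialComplex U}
    (oK : FaceOrientation K) (oM : FaceOrientation M)
    (wK : Finset V → ℝ) (wM : Finset U → ℝ)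
    (hwK : ∀ F ∈ K, 0 < wK F) (hwM : ∀ G ∈ M, 0 < wM G)
    (φ : V → U) (k : ℕ) (hφ : IsFoldCovering k K M φ)
    (hw : ∀ F ∈ K, wK F = wM (F.image φ))
    (i : ℕ) (ψ : PermVoltage (incidenceGraph M i) k) (η : DerivedIso K M φ ψ)
    (m : ℕ) (d : Fin m → ℕ)
    (ρ : ∀ j, voltageGroup ψ →* Matrix (Fin (d j)) (Fin (d j)) ℂ)
    (hρ : ∀ j, (matrixRep (ρ j)).IsIrreducible)
    (e : Fin k ≃ Unit ⊕ Σ j, Fin (d j))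
    (T : Matrix (Fin k) (Fin k) ℂ) (hT : IsUnit T)
    (hrep : ∀ g : voltageGroup ψ, T⁻¹ * permutationMatrix (g : Equiv.Perm (Fin k)) * T =
      (directSum (1 : Matrix Unit Unit ℂ) fun j => ρ j g).submatrix e e) :
    ((1 : Matrix (Face M i) (Face M i) ℂ) ⊗ₖ T)⁻¹
        * toComplex (signature oK oM η)
        * toComplex ((upLaplacian oK wK i).submatrix η.lower η.lower)
        * (toComplex (signature oK oM η))⁻¹
        * ((1 : Matrix (Face M i) (Face M i) ℂ) ⊗ₖ T) =
      (directSum (toComplex (upLaplacian oM wM i)) fun j =>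
          (∑ g : voltageGroup ψ,
            toComplex ((weightMatrix M wM i)⁻¹ * (coboundaryPart oM ψ (g : Equiv.Perm (Fin k)))ᵀ)
              ⊗ₖ ρ j g⁻¹)
          * (∑ g : voltageGroup ψ,
            toComplex (weightMatrix M wM (i + 1) * coboundaryPart oM ψ (g : Equiv.Perm (Fin k)))
              ⊗ₖ ρ j g)).submatrix (blockEquiv (Face M i) e) (blockEquiv (Face M i) e) := by
  have hsig : (toComplex (signature oK oM η))⁻¹ = toComplex (signature oK oM η) := by
    refine Matrix.inv_eq_left_inv ?_
    rw [← toComplex_mul, signature_mul_self, toComplex,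
      Matrix.map_one _ Complex.ofReal_zero Complex.ofReal_one]
  have hunit : IsUnit ((1 : Matrix (Face M (i + 1)) (Face M (i + 1)) ℂ) ⊗ₖ T).det := by
    rw [Matrix.det_kronecker, Matrix.det_one, one_pow, one_mul]
    exact ((Matrix.isUnit_iff_isUnit_det T).mp hT).pow _
  have hlow :=
    kronecker_conj_sum (X := Face M i) (Y := Face M (i + 1)) Finset.univ
      (fun g : voltageGroup ψ =>
        toComplex ((weightMatrix M wM i)⁻¹ * (coboundaryPart oM ψ (g : Equiv.Perm (Fin k)))ᵀ))
      (fun g => permutationMatrix ((g⁻¹ : voltageGroup ψ) : Equiv.Perm (Fin k))) T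
  have hup :=
    kronecker_conj_sum (X := Face M (i + 1)) (Y := Face M i) Finset.univ
      (fun g : voltageGroup ψ =>
        toComplex (weightMatrix M wM (i + 1) * coboundaryPart oM ψ (g : Equiv.Perm (Fin k))))
      (fun g => permutationMatrix (g : Equiv.Perm (Fin k))) T
  -- In `hlow` the decomposition is applied at `g⁻¹`, whence the factors `ρ j g⁻¹`.
  simp only [hrep] at hlow hup
  rw [sum_kronecker_permutationMatrix_inv ψ oM hwM,
    sum_kronecker_directSum e _ _ fun j (g : voltageGroup ψ) => ρ j g⁻¹,
    sum_weightMatrix_inv_mul_coboundaryPart ψ oM hwM] at hlow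
  rw [sum_kronecker_permutationMatrix ψ oM,
    sum_kronecker_directSum e _ _ fun j (g : voltageGroup ψ) => ρ j g,
    sum_weightMatrix_mul_coboundaryPart ψ oM] at hup
  have hlap : upLaplacian oM wM i = (weightMatrix M wM i)⁻¹ * (coboundaryMatrix oM i)ᵀ *
      (weightMatrix M wM (i + 1) * coboundaryMatrix oM i) := by
    rw [upLaplacian, coboundaryAdjointMatrix, Matrix.mul_assoc _ (weightMatrix M wM (i + 1))]
  have hprod : ∀ S L : Matrix (Face M i × Fin k) (Face M i × Fin k) ℂ,
      ((1 : Matrix (Face M i) (Face M i) ℂ) ⊗ₖ T)⁻¹ * S * L * S *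
        ((1 : Matrix (Face M i) (Face M i) ℂ) ⊗ₖ T) =
      ((1 : Matrix (Face M i) (Face M i) ℂ) ⊗ₖ T)⁻¹ * (S * L * S) *
        ((1 : Matrix (Face M i) (Face M i) ℂ) ⊗ₖ T) := fun S L => by
    simp only [Matrix.mul_assoc]
  -- Both factors now have the same block shape with the same intermediate labelling, so they
  -- multiply block by block; `hlap` identifies the first block.
  rw [hsig, hprod, ← toComplex_mul, ← toComplex_mul,
    signature_conj_upLaplacian η oK oM hwK hw, toComplex_mul,
    conj_mul_of_isUnit_det hunit, hlow, hup, Matrix.submatrix_mul_equiv,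
    Matrix.fromBlocks_multiply, ← Matrix.blockDiagonal'_mul, ← toComplex_mul, ← hlap]
  simp [directSum]
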